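/- Let $X$ be a real Banach space. For nonempty $V\subseteq X$, a nonempty finite set $F=\{x_1,\dots,x_N\}\subseteq X$ and $f:\mathbb{R}_+^N\to\mathbb{R}_+$ (where $\mathbb{R}_+=[0,\infty)$), put $$r_f(v,F)=f(\|v-x_1\|,\dots,\|v-x_N\|)\quad(v\in X),\qquad \operatorname{rad}_V^f(F)=\inf_{v\in V} r_f(v,F).$$ Let $\mathcal{F}(X)$ be the family of all nonempty finite subsets of $X$, and let $\mathcal{F}_{cmc}$ be the class of all functions $f:\mathbb{R}_+^N\to\mathbb{R}_+$, $N\in\mathbb{N}$, that are convex, monotone ($s_i\le t_i$ for all $i$ implies $f(s)\le f(t)$) and coercive ($f(t)\to\infty$ as $\|t\|_\infty\to\infty$). For a weakly closed set $V\subseteq X$, the triplet $(X,V,\mathcal{F}(X))$ is said to have weak-$\mathcal{F}_{cmc}$-SACP if for every $F=\{x_1,\dots,x_N\}\in\mathcal{F}(X)$ and every $f:\mathbb{R}_+^N\to\mathbb{R}_+$ in $\mathcal{F}_{cmc}$, each sequence $(v_n)$ in $V$ with $r_f(v_n,F)\to\operatorname{rad}_V^f(F)$ has a weakly convergent subsequence.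 **Theorem 3.10.** Let $Y$ and $Z$ be closed linear subspaces of $X$ such that $Y$ is reflexive, $Y+Z$ is closed, and $(X,Z,\mathcal{F}(X))$ has weak-$\mathcal{F}_{cmc}$-SACP. Then $(X,Y+Z,\mathcal{F}(X))$ has weak-$\mathcal{F}_{cmc}$-SACP. -/

import Mathlib

open Set Filter Topology
open scoped NNReal

noncomputable section

/-- A normed space is reflexive if its canonical embedding into the bidual is onto. -/
def IsReflexiveSpace (Y : Type*) [NormedAddCommGroup Y] [NormedSpace ℝ Y] : Prop :=
  Function.Surjective (NormedSpace.inclusionInDoubleDual ℝ Y)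

/-- The class of convex, monotone (for the coordinatewise order) and coercive functions
`ℝ₊ᴺ → ℝ₊`. Coercive means `f t → ∞` as `‖t‖_∞ → ∞`; for `t : Fin N → ℝ≥0` the sup norm is
`Finset.univ.sup t`. -/
def cmcFunctions (N : ℕ) : Set ((Fin N → ℝ≥0) → ℝ≥0) :=
  {f | ConvexOn ℝ≥0 univ f ∧ Monotone f ∧
    Tendsto f (comap (fun t : Fin N → ℝ≥0 => Finset.univ.sup t) atTop) atTop}

/-- The family of all nonempty finite subsets of `X`. -/
def finiteSubsets (X : Type*) : Set (Set X) :=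
  {F | F.Nonempty ∧ F.Finite}

section

variable {X : Type*} [NormedAddCommGroup X] [NormedSpace ℝ X]

/-- `r_f(v, F) = f(‖v - x₁‖, …, ‖v - x_N‖)` for `F = {x₁, …, x_N}`. -/
def fRadiusAt {N : ℕ} (f : (Fin N → ℝ≥0) → ℝ≥0) (x : Fin N → X) (v : X) : ℝ≥0 :=
  f fun i => ‖v - x i‖₊

/-- `rad_V^f(F) = inf_{v ∈ V} r_f(v, F)` for `F = {x₁, …, x_N}`. -/
def fRadius {N : ℕ} (V : Set X) (f : (Fin N → ℝ≥0) → ℝ≥0) (x : Fin N → X) : ℝ≥0 :=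
  sInf (fRadiusAt f x '' V)

/-- The triplet `(X, V, 𝔉)` has weak-`𝓕`-SACP: for every `F = {x₁, …, x_N}` in `𝔉` and every
`f : ℝ₊ᴺ → ℝ₊` in `𝓕`, each sequence in `V` with `r_f(v_n, F) → rad_V^f(F)` has a subsequence
that converges in the weak topology of `X`. -/
def HasWeakSACP (V : Set X) (𝔉 : Set (Set X))
    (𝓕 : (N : ℕ) → Set ((Fin N → ℝ≥0) → ℝ≥0)) : Prop :=
  ∀ F ∈ 𝔉, ∀ (N : ℕ) (x : Fin N → X), range x = F → ∀ f ∈ 𝓕 N,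
    ∀ v : ℕ → X, (∀ n, v n ∈ V) →
      Tendsto (fun n => fRadiusAt f x (v n)) atTop (𝓝 (fRadius V f x)) →
      ∃ (w : X) (φ : ℕ → ℕ), StrictMono φ ∧
        Tendsto (fun k => toWeakSpace ℝ X (v (φ k))) atTop (𝓝 (toWeakSpace ℝ X w))

end

end

section WeakConvergence

variable {X : Type*} [NormedAddCommGroup X] [NormedSpace ℝ X]

theorem tendsto_toWeakSpace_iff {ι : Type*} {l : Filter ι} {a : ι → X} {w : X} :
    Tendsto (fun i => toWeakSpace ℝ X (a i)) l (𝓝 (toWeakSpace ℝ X w)) ↔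
      ∀ g : StrongDual ℝ X, Tendsto (fun i => g (a i)) l (𝓝 (g w)) := by
  refine WeakBilin.tendsto_iff_forall_eval_tendsto (topDualPairing ℝ X).flip ?_
  intro u v huv
  exact (SeparatingDual.eq_iff_forall_dual_eq (R := ℝ)).2 fun g => LinearMap.congr_fun huv g

theorem mem_closure_of_forall_tendsto_dual {ι : Type*} {l : Filter ι} [l.NeBot] {a : ι → X}
    {w : X} {C : Set X} (hC : Convex ℝ C)
    (ha : ∀ g : StrongDual ℝ X, Tendsto (fun i => g (a i)) l (𝓝 (g w)))
    (hmem : ∀ᶠ i in l, a i ∈ C) : w ∈ closure C := by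
  by_contra hw
  obtain ⟨g, u, hgw, hg⟩ := geometric_hahn_banach_point_closed hC.closure isClosed_closure hw
  exact hgw.not_ge (ge_of_tendsto (ha g) (hmem.mono fun i hi => (hg _ (subset_closure hi)).le))

/-- The intersection of the closed convex hulls of the tails of a sequence. -/
def tailHull (x : ℕ → X) : Set X :=
  ⋂ n, closure (convexHull ℝ (x '' Ici n))

theorem apply_mem_of_mem_tailHull {x : ℕ → X} {w : X} (hw : w ∈ tailHull x)
    (g : StrongDual ℝ X) {s : Set ℝ} (hs : Convex ℝ s) (hsc : IsClosed s)
    (hx : ∀ᶠ n in atTop, g (x n) ∈ s) : g w ∈ s := by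
  obtain ⟨n, hn⟩ := eventually_atTop.1 hx
  have hsub : closure (convexHull ℝ (x '' Ici n)) ⊆ g ⁻¹' s := by
    refine closure_minimal (convexHull_min ?_ ?_) (hsc.preimage g.continuous)
    · rintro _ ⟨k, hk, rfl⟩
      exact hn k hk
    · exact hs.linear_preimage g.toLinearMap
  exact hsub (mem_iInter.1 hw n)

theorem apply_eq_of_mem_tailHull {x : ℕ → X} {w : X} (hw : w ∈ tailHull x)
    (g : StrongDual ℝ X) {c : ℝ} (hx : Tendsto (fun n => g (x n)) atTop (𝓝 c)) : g w = c := by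
  refine eq_of_forall_dist_le fun ε hε => ?_
  exact apply_mem_of_mem_tailHull hw g (convex_closedBall c ε) Metric.isClosed_closedBall
    (hx (Metric.closedBall_mem_nhds c hε))

theorem mem_closure_span_of_mem_tailHull {x : ℕ → X} {w : X} (hw : w ∈ tailHull x) :
    w ∈ closure (Submodule.span ℝ (range x) : Set X) :=
  closure_mono (convexHull_min ((image_subset_range _ _).trans Submodule.subset_span)
    (Submodule.convex _)) (mem_iInter.1 hw 0)

theorem exists_seq_dual_separating (x : ℕ → X) :
    ∃ g : ℕ → StrongDual ℝ X, (∀ k, ‖g k‖ ≤ 1) ∧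
      ∀ w ∈ closure (Submodule.span ℝ (range x) : Set X), (∀ k, g k w = 0) → w = 0 := by
  obtain ⟨c, hc, hsub⟩ := (countable_range x).isSeparable.span (R := ℝ)
  have hne : c.Nonempty :=
    closure_nonempty_iff.1 ⟨0, hsub (Submodule.zero_mem _)⟩
  obtain ⟨d, rfl⟩ := hc.exists_eq_range hne
  choose g hg hgd using fun k => exists_dual_vector'' ℝ (d k)
  refine ⟨g, hg, fun w hw hgw => ?_⟩
  have hw' := closure_minimal hsub isClosed_closure hw
  rw [← norm_le_zero_iff]
  refine le_of_forall_pos_le_add fun ε hε => ?_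
  obtain ⟨_, ⟨k, rfl⟩, hk⟩ := Metric.mem_closure_iff.1 hw' (ε / 2) (half_pos hε)
  rw [dist_eq_norm] at hk
  have h1 : ‖d k‖ ≤ ‖w - d k‖ := by
    have h2 : g k (w - d k) = -‖d k‖ := by
      rw [map_sub, hgw, hgd]
      simp
    have h3 := (g k).le_of_opNorm_le (hg k) (w - d k)
    rw [h2, norm_neg, norm_norm, one_mul] at h3
    exact h3
  have h4 : ‖w‖ ≤ ‖w - d k‖ + ‖d k‖ := by simpa using norm_add_le (w - d k) (d k)
  linarith

theorem exists_subseq_tendsto_dual {x : ℕ → X} {R : ℝ} (hR : ∀ n, ‖x n‖ ≤ R)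
    (g : ℕ → StrongDual ℝ X) (hg : ∀ k, ‖g k‖ ≤ 1) :
    ∃ (c : ℕ → ℝ) (φ : ℕ → ℕ), StrictMono φ ∧
      ∀ k, Tendsto (fun n => g k (x (φ n))) atTop (𝓝 (c k)) := by
  have hcomp : IsCompact (univ.pi fun _ : ℕ => Metric.closedBall (0 : ℝ) R) :=
    isCompact_univ_pi fun _ => isCompact_closedBall 0 R
  have hmem : ∀ n, (fun k => g k (x n)) ∈ univ.pi fun _ : ℕ => Metric.closedBall (0 : ℝ) R := by
    intro n k _
    rw [mem_closedBall_zero_iff]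
    exact ((g k).le_of_opNorm_le (hg k) (x n)).trans (by simpa using hR n)
  obtain ⟨c, -, φ, hφ, hlim⟩ := hcomp.tendsto_subseq hmem
  exact ⟨c, φ, hφ, fun k => (tendsto_pi_nhds.1 hlim) k⟩

/-- A bounded sequence all of whose subsequences have a point common to the closed convex hulls
of their tails has a weakly convergent subsequence. -/
theorem exists_subseq_tendsto_weak {x : ℕ → X} {R : ℝ} (hR : ∀ n, ‖x n‖ ≤ R)
    (hx : ∀ φ : ℕ → ℕ, StrictMono φ → (tailHull (x ∘ φ)).Nonempty) :
    ∃ (w : X) (φ : ℕ → ℕ), StrictMono φ ∧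
      Tendsto (fun k => toWeakSpace ℝ X (x (φ k))) atTop (𝓝 (toWeakSpace ℝ X w)) := by
  obtain ⟨g, hg, hsep⟩ := exists_seq_dual_separating x
  obtain ⟨c, φ, hφ, hc⟩ := exists_subseq_tendsto_dual hR g hg
  have hspan : ∀ {ψ : ℕ → ℕ} {w : X}, w ∈ tailHull (x ∘ ψ) →
      w ∈ (Submodule.span ℝ (range x)).topologicalClosure := fun {ψ w} hw =>
    closure_mono (Submodule.span_mono (range_comp_subset_range ψ x))
      (mem_closure_span_of_mem_tailHull hw)
  obtain ⟨w, hw⟩ := hx φ hφ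
  have huniq : ∀ (ψ : ℕ → ℕ), StrictMono ψ → ∀ w' ∈ tailHull (x ∘ (φ ∘ ψ)), w' = w := by
    intro ψ hψ w' hw'
    refine sub_eq_zero.1 (hsep _ (Submodule.sub_mem _ (hspan hw') (hspan hw)) fun k => ?_)
    rw [map_sub, apply_eq_of_mem_tailHull hw (g k) (hc k),
      apply_eq_of_mem_tailHull hw' (g k) ((hc k).comp hψ.tendsto_atTop), sub_self]
  refine ⟨w, φ, hφ, tendsto_toWeakSpace_iff.2 fun h => ?_⟩
  have key : ∀ (h : StrongDual ℝ X) (u : ℝ), u < h w → ∀ᶠ n in atTop, u < h (x (φ n)) := by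
    intro h u hu
    by_contra hcon
    obtain ⟨ψ, hψ, hψu⟩ := extraction_of_frequently_atTop (not_eventually.1 hcon)
    obtain ⟨w', hw'⟩ := hx (φ ∘ ψ) (hφ.comp hψ)
    have := apply_mem_of_mem_tailHull hw' h (convex_Iic u) isClosed_Iic
      (Eventually.of_forall fun n => not_lt.1 (hψu n))
    rw [huniq ψ hψ w' hw'] at this
    exact hu.not_ge this
  refine tendsto_order.2 ⟨fun u hu => key h u hu, fun u hu => ?_⟩
  filter_upwards [key (-h) (-u) (by simpa using hu)] with n hn
  simpa using hn

/-- Bounded sequences in a reflexive space have a point common to the closed convex hulls of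
their tails. -/
theorem IsReflexiveSpace.tailHull_nonempty (hX : IsReflexiveSpace X) {y : ℕ → X} {R : ℝ}
    (hR : ∀ n, ‖y n‖ ≤ R) : (tailHull y).Nonempty := by
  let J : ℕ → WeakDual ℝ (StrongDual ℝ X) := fun n =>
    StrongDual.toWeakDual (NormedSpace.inclusionInDoubleDual ℝ X (y n))
  have hJ : ∀ n, J n ∈ WeakDual.toStrongDual ⁻¹'
      Metric.closedBall (0 : StrongDual ℝ (StrongDual ℝ X)) R := by
    intro n
    have h : ‖NormedSpace.inclusionInDoubleDual ℝ X (y n)‖ ≤ R :=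
      (NormedSpace.double_dual_bound ℝ X (y n)).trans (hR n)
    exact (mem_closedBall_zero_iff (E := StrongDual ℝ (StrongDual ℝ X))).2 h
  obtain ⟨ξ, -, hξ⟩ := (WeakDual.isCompact_closedBall (𝕜 := ℝ) 0 R).ultrafilter_le_nhds
    ((hyperfilter ℕ : Ultrafilter ℕ).map J)
    (Filter.le_principal_iff.2 (Filter.mem_map.2 (Filter.univ_mem' hJ)))
  obtain ⟨w, hw⟩ := hX (WeakDual.toStrongDual ξ)
  refine ⟨w, mem_iInter.2 fun n => ?_⟩
  refine mem_closure_of_forall_tendsto_dual (l := (hyperfilter ℕ : Filter ℕ)) (a := y)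
    (convex_convexHull ℝ _) (fun g => ?_) ?_
  · have h1 : Tendsto J (hyperfilter ℕ : Filter ℕ) (𝓝 ξ) := hξ
    have h2 := (WeakDual.eval_continuous g).continuousAt.tendsto.comp h1
    have h3 : g w = ξ g := by
      rw [← NormedSpace.dual_def ℝ X w g, hw]
      rfl
    rw [h3]
    exact h2
  · have : ∀ᶠ k in atTop, y k ∈ convexHull ℝ (y '' Ici n) :=
      eventually_atTop.2 ⟨n, fun k hk => subset_convexHull ℝ _ (mem_image_of_mem y hk)⟩
    exact (Nat.hyperfilter_le_atTop) this

/-- Vectors of a closed sum of closed subspaces split with control of the first summand. -/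
theorem exists_bounded_splitting [CompleteSpace X] {Y Z : Submodule ℝ X}
    (hY : IsClosed (Y : Set X)) (hZ : IsClosed (Z : Set X))
    (hYZ : IsClosed ((Y ⊔ Z : Submodule ℝ X) : Set X)) :
    ∃ C : ℝ, 0 < C ∧ ∀ v ∈ Y ⊔ Z, ∃ (y : Y) (z : Z), (y : X) + z = v ∧ ‖y‖ ≤ C * ‖v‖ := by
  have := hY.completeSpace_coe
  have := hZ.completeSpace_coe
  have := hYZ.completeSpace_coe
  let T : (Y × Z) →L[ℝ] (Y ⊔ Z : Submodule ℝ X) :=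
    (Y.subtypeL.coprod Z.subtypeL).codRestrict (Y ⊔ Z) fun p =>
      Submodule.add_mem_sup p.1.2 p.2.2
  have hT : Function.Surjective T := by
    rintro ⟨v, hv⟩
    obtain ⟨y, hy, z, hz, rfl⟩ := Submodule.mem_sup.1 hv
    exact ⟨(⟨y, hy⟩, ⟨z, hz⟩), rfl⟩
  obtain ⟨C, hC, h⟩ := T.exists_preimage_norm_le hT
  refine ⟨C, hC, fun v hv => ?_⟩
  obtain ⟨p, hp, hpn⟩ := h ⟨v, hv⟩
  exact ⟨p.1, p.2, congrArg Subtype.val hp, (norm_fst_le p).trans hpn⟩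

end WeakConvergence

section Radius

variable {N : ℕ} {f : (Fin N → ℝ≥0) → ℝ≥0}

theorem le_add_of_mem_cmcFunctions (hf : f ∈ cmcFunctions N) {R δ : ℝ≥0} (hδ : δ ≤ 1)
    {a b : Fin N → ℝ≥0} (ha : ∀ i, a i ≤ R) (hb : ∀ i, b i ≤ a i + δ) :
    f b ≤ f a + δ * f fun _ => R + 1 := by
  obtain ⟨hconv, hmono, -⟩ := hf
  have hsum : (1 - δ) + δ = 1 := tsub_add_cancel_of_le hδ
  have h1 : f b ≤ f ((1 - δ) • a + δ • fun i => a i + 1) := hmono fun i => by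
    calc b i ≤ a i + δ := hb i
      _ = ((1 - δ) + δ) * a i + δ := by rw [hsum, one_mul]
      _ = _ := by simp only [Pi.add_apply, Pi.smul_apply, smul_eq_mul]; ring
  have h2 := hconv.2 (mem_univ a) (mem_univ fun i => a i + 1) (zero_le (a := 1 - δ))
    (zero_le (a := δ)) hsum
  refine h1.trans (h2.trans (add_le_add ?_ ?_))
  · exact mul_le_of_le_one_left zero_le tsub_le_self
  · exact mul_le_mul_right (hmono fun i => add_le_add_left (ha i) 1) δ

variable {X : Type*} [NormedAddCommGroup X]

/-- Coercivity: sublevel sets of `r_f(·, F)` are bounded. -/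
theorem exists_nnnorm_sub_le_of_fRadiusAt_le (hf : f ∈ cmcFunctions N) (x : Fin N → X)
    (c : ℝ≥0) : ∃ R : ℝ≥0, ∀ v, fRadiusAt f x v ≤ c → ∀ i, ‖v - x i‖₊ ≤ R := by
  obtain ⟨-, -, hcoer⟩ := hf
  obtain ⟨s, hs, hsub⟩ := mem_comap.1 (hcoer (eventually_gt_atTop c))
  obtain ⟨R, hR⟩ := mem_atTop_sets.1 hs
  refine ⟨R, fun v hv i => ?_⟩
  by_contra hlt
  have h1 : R ≤ Finset.univ.sup fun i => ‖v - x i‖₊ :=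
    (not_le.1 hlt).le.trans (Finset.le_sup (f := fun i => ‖v - x i‖₊) (Finset.mem_univ i))
  have h2 : c < fRadiusAt f x v := hsub (hR _ h1)
  exact h2.not_ge hv

theorem fRadius_le {V : Set X} {v : X} (hv : v ∈ V) (x : Fin N → X) :
    fRadius V f x ≤ fRadiusAt f x v :=
  csInf_le (OrderBot.bddBelow _) (mem_image_of_mem _ hv)

theorem fRadiusAt_add (x : Fin N → X) (u v : X) :
    fRadiusAt f x (u + v) = fRadiusAt f (fun i => x i - u) v := by
  have h : ∀ i, u + v - x i = v - (x i - u) := fun i => by abel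
  simp only [fRadiusAt, h]

variable [NormedSpace ℝ X]

theorem convex_setOf_fRadiusAt_le (hf : f ∈ cmcFunctions N) (x : Fin N → X) (c : ℝ≥0) :
    Convex ℝ {v : X | fRadiusAt f x v ≤ c} := by
  obtain ⟨hconv, hmono, -⟩ := hf
  intro u hu v hv a b ha hb hab
  lift a to ℝ≥0 using ha
  lift b to ℝ≥0 using hb
  have hab' : a + b = 1 := by exact_mod_cast hab
  have h1 : fRadiusAt f x ((a : ℝ) • u + (b : ℝ) • v) ≤
      f (a • (fun i => ‖u - x i‖₊) + b • fun i => ‖v - x i‖₊) := hmono fun i => by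
    have h : (a : ℝ) • u + (b : ℝ) • v - x i = a • (u - x i) + b • (v - x i) := by
      have : x i = (a : ℝ) • x i + (b : ℝ) • x i := by rw [← add_smul, hab, one_smul]
      conv_lhs => rw [this]
      simp only [NNReal.smul_def]
      module
    change ‖(a : ℝ) • u + (b : ℝ) • v - x i‖₊ ≤ a * ‖u - x i‖₊ + b * ‖v - x i‖₊
    rw [h]
    refine (nnnorm_add_le _ _).trans (le_of_eq ?_)
    simp only [NNReal.smul_def, nnnorm_smul, Real.nnnorm_of_nonneg (NNReal.coe_nonneg _)]
    rfl
  have h2 := hconv.2 (mem_univ fun i => ‖u - x i‖₊) (mem_univ fun i => ‖v - x i‖₊)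
    (zero_le (a := a)) (zero_le (a := b)) hab'
  refine h1.trans (h2.trans ?_)
  calc a * fRadiusAt f x u + b * fRadiusAt f x v ≤ a * c + b * c :=
        add_le_add (mul_le_mul_right hu a) (mul_le_mul_right hv b)
    _ = c := by rw [← add_mul, hab', one_mul]

/-- If convex combinations `u n ∈ Y`, `t n ∈ Z` are such that `u n + t n` minimizes over `Y ⊔ Z`
and `u n` converges in norm, then `t n` has a weakly convergent subsequence. -/
theorem HasWeakSACP.exists_subseq_of_tendsto {Y Z : Submodule ℝ X}
    (hSACP : HasWeakSACP (Z : Set X) (finiteSubsets X) cmcFunctions)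
    (hf : f ∈ cmcFunctions N) {x : Fin N → X} (hx : (range x).Nonempty) {u t : ℕ → X} {w : X}
    (hw : w ∈ Y) (ht : ∀ n, t n ∈ Z) (hu : Tendsto u atTop (𝓝 w))
    (hmin : Tendsto (fun n => fRadiusAt f x (u n + t n)) atTop
      (𝓝 (fRadius ((Y ⊔ Z : Submodule ℝ X) : Set X) f x))) :
    ∃ (z : X) (φ : ℕ → ℕ), StrictMono φ ∧
      Tendsto (fun k => toWeakSpace ℝ X (t (φ k))) atTop (𝓝 (toWeakSpace ℝ X z)) := by
  set ρ := fRadius ((Y ⊔ Z : Submodule ℝ X) : Set X) f x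
  obtain ⟨c, hc⟩ := hmin.bddAbove_range
  obtain ⟨R, hR⟩ := exists_nnnorm_sub_le_of_fRadiusAt_le hf x c
  have hlow : ∀ z ∈ Z, ρ ≤ fRadiusAt f (fun i => x i - w) z := fun z hz => by
    rw [← fRadiusAt_add]
    exact fRadius_le (Submodule.add_mem_sup hw hz) x
  have hδ : Tendsto (fun n => ‖w - u n‖₊) atTop (𝓝 0) := by
    have := (tendsto_const_nhds (x := w)).sub hu
    simpa using this.nnnorm
  have hlim : Tendsto (fun n => fRadiusAt f (fun i => x i - w) (t n)) atTop (𝓝 ρ) := by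
    have hup : Tendsto (fun n => fRadiusAt f x (u n + t n) + ‖w - u n‖₊ * f fun _ => R + 1)
        atTop (𝓝 ρ) := by
      simpa using hmin.add (hδ.mul_const (f fun _ => R + 1))
    refine tendsto_of_tendsto_of_tendsto_of_le_of_le' tendsto_const_nhds hup
      (Eventually.of_forall fun n => hlow _ (ht n)) ?_
    filter_upwards [hδ.eventually (Iic_mem_nhds zero_lt_one)] with n hn
    rw [← fRadiusAt_add]
    refine le_add_of_mem_cmcFunctions hf hn (hR _ (hc (mem_range_self n))) fun i => ?_
    have h : w + t n - x i = (u n + t n - x i) + (w - u n) := by abel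
    rw [h]
    exact nnnorm_add_le _ _
  have hrad : fRadius (Z : Set X) f (fun i => x i - w) = ρ := by
    refine le_antisymm (ge_of_tendsto' hlim fun n => fRadius_le (ht n) _) ?_
    refine le_csInf ⟨_, mem_image_of_mem _ Z.zero_mem⟩ ?_
    rintro _ ⟨z, hz, rfl⟩
    exact hlow z hz
  refine hSACP _ ⟨?_, finite_range _⟩ N (fun i => x i - w) rfl f hf t ht (hrad ▸ hlim)
  exact range_nonempty_iff_nonempty.2 (range_nonempty_iff_nonempty.1 hx)

/-- A minimizing sequence in `Y ⊔ Z` has a point common to the closed convex hulls of its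
tails. -/
theorem tailHull_nonempty_of_tendsto {Y Z : Submodule ℝ X} (hY : IsReflexiveSpace Y)
    (hSACP : HasWeakSACP (Z : Set X) (finiteSubsets X) cmcFunctions)
    (hf : f ∈ cmcFunctions N) {x : Fin N → X} (hx : (range x).Nonempty)
    {y : ℕ → Y} {z : ℕ → Z} {R : ℝ} (hR : ∀ n, ‖y n‖ ≤ R)
    (hmin : Tendsto (fun n => fRadiusAt f x (y n + z n)) atTop
      (𝓝 (fRadius ((Y ⊔ Z : Submodule ℝ X) : Set X) f x))) :
    (tailHull fun n => (y n + z n : X)).Nonempty := by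
  obtain ⟨w, hw⟩ := hY.tailHull_nonempty hR
  have hpair : ∀ n : ℕ, ∃ p ∈ convexHull ℝ ((fun k => (y k, z k)) '' Ici n),
      dist w p.1 < 1 / ((n : ℝ) + 1) := by
    intro n
    obtain ⟨u, hu, hd⟩ := Metric.mem_closure_iff.1 (mem_iInter.1 hw n) _
      (Nat.one_div_pos_of_nat (α := ℝ) (n := n))
    have himg : y '' Ici n = LinearMap.fst ℝ Y Z '' ((fun k => (y k, z k)) '' Ici n) := by
      rw [image_image]
      rfl
    rw [himg, ← LinearMap.image_convexHull] at hu
    obtain ⟨p, hp, rfl⟩ := hu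
    exact ⟨p, hp, hd⟩
  choose p hp hpd using hpair
  let S : (Y × Z) →ₗ[ℝ] X := Y.subtype.coprod Z.subtype
  have hsum : ∀ n, (((p n).1 : X) + (p n).2) ∈
      convexHull ℝ ((fun k => (y k + z k : X)) '' Ici n) := by
    intro n
    have h := mem_image_of_mem S (hp n)
    rw [LinearMap.image_convexHull, image_image] at h
    exact h
  have hu : Tendsto (fun n => (p n).1) atTop (𝓝 w) := by
    refine tendsto_iff_dist_tendsto_zero.2 (squeeze_zero (fun _ => dist_nonneg) (fun n => ?_)
      (tendsto_one_div_add_atTop_nhds_zero_nat (𝕜 := ℝ)))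
    rw [dist_comm]
    exact (hpd n).le
  have hmin' : Tendsto (fun n => fRadiusAt f x ((p n).1 + (p n).2)) atTop
      (𝓝 (fRadius ((Y ⊔ Z : Submodule ℝ X) : Set X) f x)) := by
    refine tendsto_order.2 ⟨fun c hc => Eventually.of_forall fun n => hc.trans_le
      (fRadius_le (Submodule.add_mem_sup (p n).1.2 (p n).2.2) x), fun c hc => ?_⟩
    obtain ⟨c', hc', hcc'⟩ := exists_between hc
    obtain ⟨m, hm⟩ := eventually_atTop.1 (hmin.eventually (Iic_mem_nhds hc'))
    filter_upwards [eventually_ge_atTop m] with n hn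
    refine lt_of_le_of_lt (convexHull_min ?_ (convex_setOf_fRadiusAt_le hf x c') (hsum n)) hcc'
    rintro _ ⟨k, hk, rfl⟩
    exact hm k (hn.trans hk)
  obtain ⟨t, φ, hφ, ht⟩ := hSACP.exists_subseq_of_tendsto hf hx w.2 (fun n => (p n).2.2)
    ((continuous_subtype_val.tendsto w).comp hu) hmin'
  refine ⟨w + t, mem_iInter.2 fun n => ?_⟩
  refine mem_closure_of_forall_tendsto_dual (l := atTop)
    (a := fun k => ((p (φ k)).1 + (p (φ k)).2 : X)) (convex_convexHull ℝ _) (fun g => ?_) ?_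
  · simp only [map_add]
    refine Tendsto.add ?_ (tendsto_toWeakSpace_iff.1 ht g)
    exact ((g.continuous.comp continuous_subtype_val).tendsto w).comp
      (hu.comp hφ.tendsto_atTop)
  · filter_upwards [hφ.tendsto_atTop.eventually_ge_atTop n] with k hk
    exact convexHull_mono (image_mono (Ici_subset_Ici.2 hk)) (hsum (φ k))

end Radius

theorem theorem3p10 {X : Type*} [NormedAddCommGroup X] [NormedSpace ℝ X] [CompleteSpace X]
    (Y Z : Submodule ℝ X) (hY : IsClosed (Y : Set X)) (hYrefl : IsReflexiveSpace Y)
    (hZ : IsClosed (Z : Set X)) (hYZ : IsClosed ((Y ⊔ Z : Submodule ℝ X) : Set X))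
    (hSACP : HasWeakSACP (Z : Set X) (finiteSubsets X) cmcFunctions) :
    HasWeakSACP ((Y ⊔ Z : Submodule ℝ X) : Set X) (finiteSubsets X) cmcFunctions := by
  rintro _ ⟨hne, -⟩ N x rfl f hf v hv hlim
  obtain ⟨i⟩ := range_nonempty_iff_nonempty.1 hne
  obtain ⟨c, hc⟩ := hlim.bddAbove_range
  obtain ⟨R, hR⟩ := exists_nnnorm_sub_le_of_fRadiusAt_le hf x c
  have hbdd : ∀ n, ‖v n‖ ≤ R + ‖x i‖ := fun n => by
    have h1 : ‖v n - x i‖ ≤ R := hR _ (hc (mem_range_self n)) i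
    have h2 : ‖v n‖ ≤ ‖v n - x i‖ + ‖x i‖ := by simpa using norm_add_le (v n - x i) (x i)
    linarith
  obtain ⟨C, hC, hsplit⟩ := exists_bounded_splitting hY hZ hYZ
  choose y z hyz hyC using fun n => hsplit (v n) (hv n)
  refine exists_subseq_tendsto_weak hbdd fun φ hφ => ?_
  have hv' : v ∘ φ = fun n => ((y ∘ φ) n + (z ∘ φ) n : X) := funext fun n => (hyz (φ n)).symm
  rw [hv']
  refine tailHull_nonempty_of_tendsto hYrefl hSACP hf hne (R := C * (R + ‖x i‖))
    (fun n => (hyC (φ n)).trans (mul_le_mul_of_nonneg_left (hbdd _) hC.le)) ?_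
  have hmin := hlim.comp hφ.tendsto_atTop
  refine hmin.congr fun n => ?_
  exact congrArg (fRadiusAt f x) (hyz (φ n)).symm
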